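/- The CAR algebra is the infinite C*-tensor product $\bigotimes_{\mathbb N} M_2(\mathbb C)$: a unital C*-algebra $B$ is (a copy of) the CAR algebra if it has pairwise commuting unital C*-subalgebras $S_n\cong M_2(\mathbb C)$, $n\in\mathbb N$, which together generate $B$ as a C*-algebra, and such that for every unital C*-algebra $C$ and every family of unital $*$-homomorphisms $\varphi_n\colon S_n\to C$ with pairwise commuting ranges there is a unital $*$-homomorphism $\Phi\colon B\to C$ with $\Phi|_{S_n}=\varphi_n$ for all $n$. The (maximal) tensor product of any other family of unital C*-algebras is defined by the same two properties. For a C*-subalgebra $A\subseteq B$ let $Z_B(A)=\{b\in B: ab=ba \text{ for all } a\in A\}$ be its relative commutant. The CAR algebra exists, and whenever $B$ is the CAR algebra, there is a proper unital C*-subalgebra $A\subsetneq B$ such that $A$ is itself the CAR algebra and $Z_B(A)=\mathbb C 1$. In particular, $B\neq A\otimes Z_B(A)$: the algebra $B$ is not the tensor product of its subalgebras $A$ and $Z_B(A)$, and indeed the C*-subalgebra of $B$ generated by $A\cup Z_B(A)$ is not $B$. (This answers Dixmier's Problem 8.3 negatively.) -/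

import Mathlib

universe u

/-- A unital C⋆-algebra `B` is the (maximal) C⋆-tensor product of a family `S` of its unital
C⋆-subalgebras: the members of `S` commute with each other, together they generate `B` as a
C⋆-algebra, and every family of unital star-homomorphisms from the members of `S` to a unital
C⋆-algebra with mutually commuting ranges extends to a unital star-homomorphism on `B`. -/
structure IsCStarTensorProduct {ι : Type*} {B : Type u} [CStarAlgebra B]
    (S : ι → StarSubalgebra ℂ B) : Prop where
  isClosed : ∀ i, IsClosed (S i : Set B)
  commute : ∀ i j, i ≠ j → ∀ a ∈ S i, ∀ b ∈ S j, Commute a b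
  generates : (⨆ i, S i).topologicalClosure = ⊤
  universal : ∀ (C : Type u) [CStarAlgebra C] (φ : ∀ i, S i →⋆ₐ[ℂ] C),
    (∀ i j, i ≠ j → ∀ (a : S i) (b : S j), Commute (φ i a) (φ j b)) →
      ∃ Φ : B →⋆ₐ[ℂ] C, ∀ (i) (a : S i), Φ (a : B) = φ i a

/-- `B` is the CAR algebra: the C⋆-tensor product of countably infinitely many copies of the
algebra of complex two-by-two matrices. -/
def IsCARAlgebra (B : Type u) [CStarAlgebra B] : Prop :=
  ∃ S : ℕ → StarSubalgebra ℂ B,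
    (∀ n, Nonempty (S n ≃⋆ₐ[ℂ] CStarMatrix (Fin 2) (Fin 2) ℂ)) ∧ IsCStarTensorProduct S

/-! A CAR algebra is the same thing as a nontrivial C⋆-algebra generated by a Pauli system `x`, `z`:
an anticommuting pair yields matrix units (`exists_starAlgHom_of_anticommute`), and the universal
property holds because the Pauli relations determine the norm (`norm_map_of_mem_pauliClosure`,
`exists_starAlgHom`).

Let `A` be generated by `x n * x (n + 1)` and `z 0 * ⋯ * z n`. These form a Pauli system again
(`even`), so `A` is a CAR algebra. It is proper because the endomorphism `x n ↦ -x n`, `z n ↦ z n`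
fixes `A` pointwise but moves `x 0` (`x_notMem_even`).

The relative commutant is trivial by averaging. Let `b` commute with `A` and let `y` in a finite
stage approximate it. Conjugations by `z n` and `x n * x (n + 1)`, both in `A`, fix `b`; averaging
over them removes the terms of `y` at its last site `n` without increasing the distance to `b`.
Descending through the sites leaves a scalar (`exists_norm_algebraMap_sub_le`, `centralizer_even`).
Hence `A` and its commutant generate only `A`, which refutes both the tensor decomposition and
generation. -/

/-- Two sequences of self-adjoint unitaries satisfying the relations of the Pauli matrices `σ_x`
and `σ_z` on the sites of a spin chain: they anticommute at each site and commute at different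
sites. -/
structure IsPauliSystem {B : Type*} [Ring B] [StarRing B] (x z : ℕ → B) : Prop where
  star_x : ∀ n, star (x n) = x n
  star_z : ∀ n, star (z n) = z n
  x_mul_x : ∀ n, x n * x n = 1
  z_mul_z : ∀ n, z n * z n = 1
  z_mul_x : ∀ n, z n * x n = -(x n * z n)
  commute_x : ∀ n m, n ≠ m → Commute (x n) (x m)
  commute_z : ∀ n m, n ≠ m → Commute (z n) (z m)
  commute_xz : ∀ n m, n ≠ m → Commute (x n) (z m)

/-! ### Pauli matrices as generators of the two-by-two matrices. -/

/-- The Pauli matrix `σ_x`. -/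
def sigmaX : CStarMatrix (Fin 2) (Fin 2) ℂ := CStarMatrix.ofMatrix !![0, 1; 1, 0]

/-- The Pauli matrix `σ_z`. -/
def sigmaZ : CStarMatrix (Fin 2) (Fin 2) ℂ := CStarMatrix.ofMatrix !![1, 0; 0, -1]

theorem star_sigmaX : star sigmaX = sigmaX := by
  ext i j; fin_cases i <;> fin_cases j <;> simp [sigmaX, CStarMatrix.star_apply]

theorem star_sigmaZ : star sigmaZ = sigmaZ := by
  ext i j; fin_cases i <;> fin_cases j <;> simp [sigmaZ, CStarMatrix.star_apply]

theorem sigmaX_mul_self : sigmaX * sigmaX = 1 := by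
  ext i j; fin_cases i <;> fin_cases j <;>
    simp [sigmaX, CStarMatrix.mul_apply, Fin.sum_univ_two]

theorem sigmaZ_mul_self : sigmaZ * sigmaZ = 1 := by
  ext i j; fin_cases i <;> fin_cases j <;>
    simp [sigmaZ, CStarMatrix.mul_apply, Fin.sum_univ_two]

theorem sigmaZ_mul_sigmaX : sigmaZ * sigmaX = -(sigmaX * sigmaZ) := by
  ext i j; fin_cases i <;> fin_cases j <;>
    simp [sigmaX, sigmaZ, CStarMatrix.mul_apply, Fin.sum_univ_two]

/-- The four Pauli words `1`, `σ_z`, `σ_x`, `σ_z σ_x` already span the matrices linearly. -/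
theorem adjoin_sigmaX_sigmaZ : StarAlgebra.adjoin ℂ {sigmaX, sigmaZ} = ⊤ := by
  rw [StarSubalgebra.eq_top_iff]
  intro M
  have hX : sigmaX ∈ StarAlgebra.adjoin ℂ {sigmaX, sigmaZ} :=
    StarAlgebra.subset_adjoin _ _ (by simp)
  have hZ : sigmaZ ∈ StarAlgebra.adjoin ℂ {sigmaX, sigmaZ} :=
    StarAlgebra.subset_adjoin _ _ (by simp)
  have hM : M = ((M 0 0 + M 1 1) / 2) • 1 + ((M 0 0 - M 1 1) / 2) • sigmaZ +
      (((M 0 1 + M 1 0) / 2) • sigmaX + ((M 0 1 - M 1 0) / 2) • (sigmaZ * sigmaX)) := by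
    ext i j; fin_cases i <;> fin_cases j <;>
      simp [sigmaX, sigmaZ, CStarMatrix.mul_apply, Fin.sum_univ_two] <;> ring
  rw [hM]
  exact add_mem (add_mem (StarSubalgebra.smul_mem _ (one_mem _) _) (StarSubalgebra.smul_mem _ hZ _))
    (add_mem (StarSubalgebra.smul_mem _ hX _) (StarSubalgebra.smul_mem _ (mul_mem hZ hX) _))

/-- A pair of anticommuting self-adjoint unitaries determines a unital star-homomorphism from the
two-by-two matrices. -/
theorem exists_starAlgHom_of_anticommute {B : Type*} [Ring B] [StarRing B] [Algebra ℂ B]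
    [StarModule ℂ B] {x z : B} (hx : star x = x) (hz : star z = z) (hxx : x * x = 1)
    (hzz : z * z = 1) (hzx : z * x = -(x * z)) :
    ∃ θ : CStarMatrix (Fin 2) (Fin 2) ℂ →⋆ₐ[ℂ] B, θ sigmaX = x ∧ θ sigmaZ = z := by
  -- The spectral projection of `z` for the eigenvalue 1. The matrix units will be `p`, `p * x`, `x
  -- * p`, `x * p * x`.
  obtain ⟨p, hp⟩ : ∃ p : B, p = (1 / 2 : ℂ) • (1 + z) := ⟨_, rfl⟩
  have hxx' : ∀ a, x * (x * a) = a := fun a => by rw [← mul_assoc, hxx, one_mul]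
  have hxzx : x * (z * x) = -z := by rw [hzx, mul_neg, hxx']
  have hpp : p * p = p := by
    simp only [hp, smul_mul_smul_comm, mul_add, add_mul, hzz, one_mul, mul_one]; module
  have hpp' : ∀ a, p * (p * a) = p * a := fun a => by rw [← mul_assoc, hpp]
  have hq : x * (p * x) = 1 - p := by
    simp only [hp, smul_mul_assoc, mul_smul_comm, mul_add, add_mul, one_mul, hxzx, hxx]; module
  have hpxp : p * (x * p) = 0 := by
    calc p * (x * p) = p * (x * (p * x)) * x := by simp only [mul_assoc, hxx, mul_one]
      _ = 0 := by rw [hq, mul_sub, mul_one, hpp, sub_self, zero_mul]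
  have hpxp' : ∀ a, p * (x * (p * a)) = 0 := fun a => by
    rw [← mul_assoc x, ← mul_assoc, hpxp, zero_mul]
  have hsp : star p = p := by simp [hp, hz]
  let f : CStarMatrix (Fin 2) (Fin 2) ℂ → B := fun M =>
    M 0 0 • p + M 0 1 • (p * x) + (M 1 0 • (x * p) + M 1 1 • (x * (p * x)))
  have hf : ∀ M, f M =
    M 0 0 • p + M 0 1 • (p * x) + (M 1 0 • (x * p) + M 1 1 • (x * (p * x))) := fun _ => rfl
  have hf1 : ∀ c : ℂ, f (algebraMap ℂ _ c) = algebraMap ℂ B c := fun c => by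
    rw [Algebra.algebraMap_eq_smul_one, Algebra.algebraMap_eq_smul_one, hf]
    simp [hq, ← smul_add]
  refine ⟨{ toFun := f, map_one' := ?_, map_mul' := ?_, map_zero' := ?_, map_add' := ?_,
            commutes' := hf1, map_star' := ?_ }, ?_, ?_⟩
  · simpa using hf1 1
  · intro M N
    simp only [hf, CStarMatrix.mul_apply, Fin.sum_univ_two, mul_add, add_mul,
      smul_mul_smul_comm, mul_assoc, hpp, hpp', hxx', hpxp, hpxp', mul_zero, smul_zero]
    module
  · simp [hf]
  · intro M N
    simp only [hf, CStarMatrix.add_apply]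
    module
  · intro M
    simp only [hf, CStarMatrix.star_apply, star_add, star_smul, star_mul, hx, hsp, mul_assoc]
    abel
  · change f sigmaX = x
    have h : p * x = x - x * p := by
      have := congrArg (x * ·) hq
      simpa [hxx', mul_sub] using this
    rw [hf]
    simp [sigmaX, h]
  · change f sigmaZ = z
    rw [hf]
    simp only [hq]
    simp [sigmaZ]
    rw [hp]
    module

/-! ### Finite stages and their Pauli expansions. -/

/-- The star-subalgebra generated by the first `n` pairs of a Pauli system. -/
def pauliStage {B : Type*} [CStarAlgebra B] (x z : ℕ → B) (n : ℕ) : StarSubalgebra ℂ B :=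
  StarAlgebra.adjoin ℂ (x '' Set.Iio n ∪ z '' Set.Iio n)

/-- The C⋆-subalgebra generated by a Pauli system. -/
def pauliClosure {B : Type*} [CStarAlgebra B] (x z : ℕ → B) : StarSubalgebra ℂ B :=
  (StarAlgebra.adjoin ℂ (Set.range x ∪ Set.range z)).topologicalClosure

section Stage

variable {B : Type*} [CStarAlgebra B] {x z : ℕ → B}

theorem x_mem_pauliStage {k n : ℕ} (h : k < n) : x k ∈ pauliStage x z n :=
  StarAlgebra.subset_adjoin _ _ (Or.inl ⟨k, h, rfl⟩)

theorem z_mem_pauliStage {k n : ℕ} (h : k < n) : z k ∈ pauliStage x z n :=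
  StarAlgebra.subset_adjoin _ _ (Or.inr ⟨k, h, rfl⟩)

theorem pauliStage_le_iff {n : ℕ} {T : StarSubalgebra ℂ B} :
    pauliStage x z n ≤ T ↔ ∀ k < n, x k ∈ T ∧ z k ∈ T := by
  rw [pauliStage, StarAlgebra.adjoin_le_iff, Set.union_subset_iff]
  simp only [Set.image_subset_iff]
  exact ⟨fun h k hk => ⟨h.1 hk, h.2 hk⟩, fun h => ⟨fun k hk => (h k hk).1, fun k hk => (h k hk).2⟩⟩

theorem pauliStage_mono : Monotone (pauliStage x z) := fun _ _ h =>
  pauliStage_le_iff.2 fun _ hk =>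
    ⟨x_mem_pauliStage (hk.trans_le h), z_mem_pauliStage (hk.trans_le h)⟩

theorem pauliStage_zero : pauliStage x z 0 = ⊥ :=
  le_antisymm (pauliStage_le_iff.2 fun _ hk => absurd hk (Nat.not_lt_zero _)) bot_le

theorem isClosed_pauliClosure : IsClosed (pauliClosure x z : Set B) :=
  StarSubalgebra.isClosed_topologicalClosure _

theorem x_mem_pauliClosure (n : ℕ) : x n ∈ pauliClosure x z :=
  StarSubalgebra.le_topologicalClosure _ (StarAlgebra.subset_adjoin _ _ (Or.inl ⟨n, rfl⟩))

theorem z_mem_pauliClosure (n : ℕ) : z n ∈ pauliClosure x z :=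
  StarSubalgebra.le_topologicalClosure _ (StarAlgebra.subset_adjoin _ _ (Or.inr ⟨n, rfl⟩))

theorem pauliClosure_le {T : StarSubalgebra ℂ B} (hT : IsClosed (T : Set B))
    (hx : ∀ n, x n ∈ T) (hz : ∀ n, z n ∈ T) : pauliClosure x z ≤ T := by
  refine StarSubalgebra.topologicalClosure_minimal (StarAlgebra.adjoin_le ?_) hT
  rintro _ (⟨n, rfl⟩ | ⟨n, rfl⟩)
  exacts [hx n, hz n]

/-- The finite stages are dense in the C⋆-algebra generated by a Pauli system. -/
theorem pauliClosure_subset_closure :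
    (pauliClosure x z : Set B) ⊆ closure (⋃ n, (pauliStage x z n : Set B)) := by
  rw [← StarSubalgebra.coe_iSup_of_directed pauliStage_mono.directed_le]
  have h : pauliClosure x z ≤ (⨆ n, pauliStage x z n).topologicalClosure :=
    pauliClosure_le (StarSubalgebra.isClosed_topologicalClosure _)
      (fun n => StarSubalgebra.le_topologicalClosure _
        (le_iSup (pauliStage x z) (n + 1) (x_mem_pauliStage n.lt_succ_self)))
      (fun n => StarSubalgebra.le_topologicalClosure _
        (le_iSup (pauliStage x z) (n + 1) (z_mem_pauliStage n.lt_succ_self)))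
  exact h

theorem commute_pauliStage {n : ℕ} {c : B} (hc : star c = c)
    (h : ∀ k < n, Commute c (x k) ∧ Commute c (z k)) {d : B} (hd : d ∈ pauliStage x z n) :
    Commute c d := by
  have hle : pauliStage x z n ≤ StarSubalgebra.centralizer ℂ {c} :=
    pauliStage_le_iff.2 fun k hk => by
      simp only [StarSubalgebra.mem_centralizer_iff, Set.mem_singleton_iff, forall_eq, hc]
      exact ⟨⟨(h k hk).1, (h k hk).1⟩, ⟨(h k hk).2, (h k hk).2⟩⟩
  exact ((StarSubalgebra.mem_centralizer_iff ℂ).1 (hle hd) c rfl).1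

namespace IsPauliSystem

theorem commute_x_pauliStage (h : IsPauliSystem x z) {n m : ℕ} (hnm : n ≤ m) {d : B}
    (hd : d ∈ pauliStage x z n) : Commute (x m) d :=
  commute_pauliStage (h.star_x m) (fun k hk =>
    ⟨h.commute_x m k (by omega), h.commute_xz m k (by omega)⟩) hd

theorem commute_z_pauliStage (h : IsPauliSystem x z) {n m : ℕ} (hnm : n ≤ m) {d : B}
    (hd : d ∈ pauliStage x z n) : Commute (z m) d :=
  commute_pauliStage (h.star_z m) (fun k hk =>
    ⟨(h.commute_xz k m (by omega)).symm, h.commute_z m k (by omega)⟩) hd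

/-- The product of two elements decomposed along the Pauli words of one site. -/
theorem decomposition_mul (h : IsPauliSystem x z) {n : ℕ} {a₀ a₁ a₂ a₃ b₀ b₁ b₂ b₃ : B}
    (h₀ : b₀ ∈ pauliStage x z n) (h₁ : b₁ ∈ pauliStage x z n) (h₂ : b₂ ∈ pauliStage x z n)
    (h₃ : b₃ ∈ pauliStage x z n) :
    (a₀ + a₁ * x n + a₂ * z n + a₃ * (x n * z n)) * (b₀ + b₁ * x n + b₂ * z n + b₃ * (x n * z n)) =
      (a₀ * b₀ + a₁ * b₁ + a₂ * b₂ - a₃ * b₃) + (a₀ * b₁ + a₁ * b₀ - a₂ * b₃ + a₃ * b₂) * x n +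
      (a₀ * b₂ + a₁ * b₃ + a₂ * b₀ - a₃ * b₁) * z n +
      (a₀ * b₃ + a₁ * b₂ - a₂ * b₁ + a₃ * b₀) * (x n * z n) := by
  have hx : ∀ {b}, b ∈ pauliStage x z n → ∀ c, x n * (b * c) = b * (x n * c) := fun hb c => by
    rw [← mul_assoc, (h.commute_x_pauliStage le_rfl hb).eq, mul_assoc]
  have hz : ∀ {b}, b ∈ pauliStage x z n → ∀ c, z n * (b * c) = b * (z n * c) := fun hb c => by
    rw [← mul_assoc, (h.commute_z_pauliStage le_rfl hb).eq, mul_assoc]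
  have hxx : ∀ c, x n * (x n * c) = c := fun c => by rw [← mul_assoc, h.x_mul_x, one_mul]
  have hzx : ∀ c, z n * (x n * c) = -(x n * (z n * c)) := fun c => by
    rw [← mul_assoc, h.z_mul_x, neg_mul, mul_assoc]
  simp only [mul_add, add_mul, sub_mul, mul_assoc, hx h₀, hx h₁, hx h₂, hx h₃,
    hz h₁, hz h₂, hz h₃, (h.commute_x_pauliStage le_rfl h₀).eq,
    (h.commute_x_pauliStage le_rfl h₂).eq, (h.commute_z_pauliStage le_rfl h₀).eq,
    hxx, hzx, h.x_mul_x, h.z_mul_z, h.z_mul_x, mul_neg, mul_one]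
  abel

/-- Expressions of this shape contain the generators and are closed under products by
`decomposition_mul` and under `star`, where only the coefficient of `x n * z n` changes sign. -/
theorem exists_decomposition (h : IsPauliSystem x z) {n : ℕ} {y : B}
    (hy : y ∈ pauliStage x z (n + 1)) :
    ∃ d₀ ∈ pauliStage x z n, ∃ d₁ ∈ pauliStage x z n, ∃ d₂ ∈ pauliStage x z n,
      ∃ d₃ ∈ pauliStage x z n, y = d₀ + d₁ * x n + d₂ * z n + d₃ * (x n * z n) := by
  rw [pauliStage] at hy
  induction hy using StarAlgebra.adjoin_induction with
  | mem y hy =>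
    rcases hy with ⟨k, hk, rfl⟩ | ⟨k, hk, rfl⟩
    · rcases Nat.lt_succ_iff_lt_or_eq.1 (Set.mem_Iio.1 hk) with hk | rfl
      · exact ⟨_, x_mem_pauliStage hk, 0, zero_mem _, 0, zero_mem _, 0, zero_mem _, by simp⟩
      · exact ⟨0, zero_mem _, 1, one_mem _, 0, zero_mem _, 0, zero_mem _, by simp⟩
    · rcases Nat.lt_succ_iff_lt_or_eq.1 (Set.mem_Iio.1 hk) with hk | rfl
      · exact ⟨_, z_mem_pauliStage hk, 0, zero_mem _, 0, zero_mem _, 0, zero_mem _, by simp⟩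
      · exact ⟨0, zero_mem _, 0, zero_mem _, 1, one_mem _, 0, zero_mem _, by simp⟩
  | algebraMap r =>
    exact ⟨_, algebraMap_mem _ r, 0, zero_mem _, 0, zero_mem _, 0, zero_mem _, by simp⟩
  | add y w _ _ hy hw =>
    obtain ⟨a₀, ha₀, a₁, ha₁, a₂, ha₂, a₃, ha₃, rfl⟩ := hy
    obtain ⟨b₀, hb₀, b₁, hb₁, b₂, hb₂, b₃, hb₃, rfl⟩ := hw
    exact ⟨_, add_mem ha₀ hb₀, _, add_mem ha₁ hb₁, _, add_mem ha₂ hb₂, _, add_mem ha₃ hb₃, by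
      simp only [add_mul]; abel⟩
  | mul y w _ _ hy hw =>
    obtain ⟨a₀, ha₀, a₁, ha₁, a₂, ha₂, a₃, ha₃, rfl⟩ := hy
    obtain ⟨b₀, hb₀, b₁, hb₁, b₂, hb₂, b₃, hb₃, rfl⟩ := hw
    refine ⟨_, ?_, _, ?_, _, ?_, _, ?_, h.decomposition_mul hb₀ hb₁ hb₂ hb₃⟩
    all_goals
      repeat' first
        | apply add_mem
        | apply sub_mem
        | apply mul_mem
        | assumption
  | star y _ hy =>
    obtain ⟨a₀, ha₀, a₁, ha₁, a₂, ha₂, a₃, ha₃, rfl⟩ := hy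
    refine ⟨_, star_mem ha₀, _, star_mem ha₁, _, star_mem ha₂, _, neg_mem (star_mem ha₃), ?_⟩
    simp only [star_add, star_mul, h.star_x, h.star_z, h.z_mul_x,
      (h.commute_x_pauliStage le_rfl (star_mem ha₁)).eq,
      (h.commute_z_pauliStage le_rfl (star_mem ha₂)).eq, neg_mul, mul_assoc,
      (h.commute_z_pauliStage le_rfl (star_mem ha₃)).eq]
    rw [← mul_assoc (x n), (h.commute_x_pauliStage le_rfl (star_mem ha₃)).eq, mul_assoc]

/-- Makes each stage closed, hence a C⋆-algebra to which automatic isometry of injective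
homomorphisms applies. -/
theorem finiteDimensional_pauliStage (h : IsPauliSystem x z) (n : ℕ) :
    FiniteDimensional ℂ (Subalgebra.toSubmodule (pauliStage x z n).toSubalgebra) := by
  induction n with
  | zero =>
    rw [pauliStage_zero, StarSubalgebra.bot_toSubalgebra]
    exact inferInstanceAs (FiniteDimensional ℂ (⊥ : Subalgebra ℂ B))
  | succ n ih =>
    let S := Subalgebra.toSubmodule (pauliStage x z n).toSubalgebra
    refine Submodule.finiteDimensional_of_le (S₂ := S ⊔ S.map (LinearMap.mulRight ℂ (x n)) ⊔
      S.map (LinearMap.mulRight ℂ (z n)) ⊔ S.map (LinearMap.mulRight ℂ (x n * z n))) ?_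
    intro y hy
    obtain ⟨a₀, ha₀, a₁, ha₁, a₂, ha₂, a₃, ha₃, rfl⟩ := h.exists_decomposition hy
    exact Submodule.add_mem_sup (Submodule.add_mem_sup (Submodule.add_mem_sup ha₀
      (Submodule.mem_map_of_mem (f := LinearMap.mulRight ℂ (x n)) ha₁))
      (Submodule.mem_map_of_mem (f := LinearMap.mulRight ℂ (z n)) ha₂))
      (Submodule.mem_map_of_mem (f := LinearMap.mulRight ℂ (x n * z n)) ha₃)

theorem isClosed_pauliStage (h : IsPauliSystem x z) (n : ℕ) :
    IsClosed (pauliStage x z n : Set B) := by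
  have := h.finiteDimensional_pauliStage n
  exact Submodule.closed_of_finiteDimensional
    (Subalgebra.toSubmodule (pauliStage x z n).toSubalgebra)

end IsPauliSystem

/-! ### Averaging, uniqueness of the norm and universality. -/

/-- Averaging over the conjugation by a self-adjoint unitary `c` does not increase the distance
to an element commuting with `c`. -/
theorem norm_sub_le_of_anticommute {b c u v : B} (hc : star c = c) (hcc : c * c = 1)
    (hcb : Commute c b) (hcu : Commute c u) (hcv : c * v = -(v * c)) :
    ‖u - b‖ ≤ ‖u + v - b‖ := by
  have hU : c ∈ unitary B := by simp [Unitary.mem_iff, hc, hcc]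
  -- Conjugation by `c` fixes `u` and `b` and negates `v`, so `v` cancels in the sum.
  have h : (2 : ℂ) • (u - b) = (u + v - b) + c * (u + v - b) * c := by
    simp only [mul_sub, mul_add, hcb.eq, hcu.eq, hcv, add_mul, sub_mul, mul_assoc, hcc, neg_mul,
      mul_one]
    module
  have h2 : 2 * ‖u - b‖ ≤ ‖u + v - b‖ + ‖u + v - b‖ := by
    calc 2 * ‖u - b‖ = ‖(2 : ℂ) • (u - b)‖ := by rw [norm_smul]; simp
      _ ≤ ‖u + v - b‖ + ‖c * (u + v - b) * c‖ := h ▸ norm_add_le _ _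
      _ = _ := by rw [CStarRing.norm_mul_mem_unitary _ hU, CStarRing.norm_mem_unitary_mul _ hU]
  linarith

namespace IsPauliSystem

/-- Averaging over `z n` removes both terms with `x n`, then averaging over `w` removes the `z n`
term. Leaving `w` free allows `x n` in `coeff_eq_zero` and `x n * x (n + 1)` for the relative
commutant. -/
theorem norm_coeff_sub_le (h : IsPauliSystem x z) {n : ℕ} {a₀ a₁ a₂ a₃ b w : B}
    (h₀ : a₀ ∈ pauliStage x z n) (h₁ : a₁ ∈ pauliStage x z n) (h₂ : a₂ ∈ pauliStage x z n)
    (h₃ : a₃ ∈ pauliStage x z n) (hw : star w = w) (hww : w * w = 1)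
    (hws : ∀ d ∈ pauliStage x z n, Commute w d) (hwz : w * z n = -(z n * w))
    (hzb : Commute (z n) b) (hwb : Commute w b) :
    ‖a₀ - b‖ ≤ ‖a₀ + a₁ * x n + a₂ * z n + a₃ * (x n * z n) - b‖ := by
  have hz : ∀ {d}, d ∈ pauliStage x z n → Commute (z n) d := h.commute_z_pauliStage le_rfl
  calc ‖a₀ - b‖ ≤ ‖a₀ + a₂ * z n - b‖ := norm_sub_le_of_anticommute hw hww hwb (hws _ h₀) (by
        rw [← mul_assoc, (hws _ h₂).eq, mul_assoc, hwz, mul_neg, mul_assoc])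
    _ ≤ ‖a₀ + a₂ * z n + (a₁ * x n + a₃ * (x n * z n)) - b‖ :=
        norm_sub_le_of_anticommute (h.star_z n) (h.z_mul_z n) hzb
          ((hz h₀).add_right ((hz h₂).mul_right (Commute.refl _))) (by
            rw [mul_add, ← mul_assoc, ← mul_assoc, (hz h₁).eq, (hz h₃).eq, mul_assoc, mul_assoc,
              ← mul_assoc (z n) (x n), h.z_mul_x]
            simp only [add_mul, mul_neg, neg_mul, neg_add, mul_assoc])
    _ = _ := by congr 2; abel

theorem x_mul_z (h : IsPauliSystem x z) (n : ℕ) : x n * z n = -(z n * x n) := by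
  rw [h.z_mul_x, neg_neg]

theorem coeff_eq_zero (h : IsPauliSystem x z) {n : ℕ} {a₀ a₁ a₂ a₃ : B}
    (h₀ : a₀ ∈ pauliStage x z n) (h₁ : a₁ ∈ pauliStage x z n) (h₂ : a₂ ∈ pauliStage x z n)
    (h₃ : a₃ ∈ pauliStage x z n) (hy : a₀ + a₁ * x n + a₂ * z n + a₃ * (x n * z n) = 0) :
    a₀ = 0 ∧ a₁ = 0 ∧ a₂ = 0 ∧ a₃ = 0 := by
  have key : ∀ {b₀ b₁ b₂ b₃ : B}, b₀ ∈ pauliStage x z n → b₁ ∈ pauliStage x z n →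
      b₂ ∈ pauliStage x z n → b₃ ∈ pauliStage x z n →
      b₀ + b₁ * x n + b₂ * z n + b₃ * (x n * z n) = 0 → b₀ = 0 := fun h₀ h₁ h₂ h₃ hb => by
    have := h.norm_coeff_sub_le (b := 0) h₀ h₁ h₂ h₃ (h.star_x n) (h.x_mul_x n)
      (fun d hd => h.commute_x_pauliStage le_rfl hd) (h.x_mul_z n)
      (Commute.zero_right _) (Commute.zero_right _)
    simpa [hb] using this
  have one : (1 : B) ∈ pauliStage x z n := one_mem _
  have zero : (0 : B) ∈ pauliStage x z n := zero_mem _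
  -- Right multiplication by `x n`, `z n` or `x n * z n` moves `a₁`, `a₂` or `-a₃` into the constant
  -- position, where `key` applies.
  have e₁ := h.decomposition_mul (a₀ := a₀) (a₁ := a₁) (a₂ := a₂) (a₃ := a₃) zero one zero zero
  have e₂ := h.decomposition_mul (a₀ := a₀) (a₁ := a₁) (a₂ := a₂) (a₃ := a₃) zero zero one zero
  have e₃ := h.decomposition_mul (a₀ := a₀) (a₁ := a₁) (a₂ := a₂) (a₃ := a₃) zero zero zero one
  simp only [hy, zero_mul, mul_zero, mul_one, zero_add, add_zero, zero_sub, sub_zero] at e₁ e₂ e₃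
  exact ⟨key h₀ h₁ h₂ h₃ hy, key h₁ h₀ (neg_mem h₃) (neg_mem h₂) e₁.symm,
    key h₂ h₃ h₀ h₁ e₂.symm, neg_eq_zero.1 (key (neg_mem h₃) (neg_mem h₂) h₁ h₀ e₃.symm)⟩

theorem map (h : IsPauliSystem x z) {C : Type*} [CStarAlgebra C] (f : B →⋆ₐ[ℂ] C) :
    IsPauliSystem (fun n => f (x n)) (fun n => f (z n)) where
  star_x n := by rw [← map_star, h.star_x]
  star_z n := by rw [← map_star, h.star_z]
  x_mul_x n := by rw [← map_mul, h.x_mul_x, map_one]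
  z_mul_z n := by rw [← map_mul, h.z_mul_z, map_one]
  z_mul_x n := by rw [← map_mul, h.z_mul_x, map_neg, map_mul]
  commute_x n m hnm := (h.commute_x n m hnm).map f
  commute_z n m hnm := (h.commute_z n m hnm).map f
  commute_xz n m hnm := (h.commute_xz n m hnm).map f

/-- A unital star-homomorphism to a nontrivial algebra is injective on the finite stages. -/
theorem eq_zero_of_map_eq_zero (h : IsPauliSystem x z) {C : Type*} [CStarAlgebra C] [Nontrivial C]
    (f : B →⋆ₐ[ℂ] C) {n : ℕ} {y : B} (hy : y ∈ pauliStage x z n) (hfy : f y = 0) : y = 0 := by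
  induction n generalizing y with
  | zero =>
    rw [pauliStage_zero] at hy
    obtain ⟨c, rfl⟩ := StarSubalgebra.mem_bot.1 hy
    rw [AlgHomClass.commutes, FaithfulSMul.algebraMap_eq_zero_iff] at hfy
    rw [hfy, map_zero]
  | succ n ih =>
    have hf : ∀ {d}, d ∈ pauliStage x z n →
        f d ∈ pauliStage (fun n => f (x n)) (fun n => f (z n)) n := by
      have : pauliStage x z n ≤
          (pauliStage (fun n => f (x n)) (fun n => f (z n)) n).comap f :=
        pauliStage_le_iff.2 fun k hk =>
          ⟨x_mem_pauliStage (x := fun n => f (x n)) hk, z_mem_pauliStage (z := fun n => f (z n)) hk⟩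
      exact fun {_} hd => this hd
    obtain ⟨a₀, h₀, a₁, h₁, a₂, h₂, a₃, h₃, rfl⟩ := h.exists_decomposition hy
    simp only [map_add, map_mul] at hfy
    obtain ⟨e₀, e₁, e₂, e₃⟩ := (h.map f).coeff_eq_zero (hf h₀) (hf h₁) (hf h₂) (hf h₃) hfy
    simp [ih h₀ e₀, ih h₁ e₁, ih h₂ e₂, ih h₃ e₃]

-- On each stage `f` is injective, hence isometric; the stages are dense.
open CStarAlgebra in
theorem norm_map_of_mem_pauliClosure (h : IsPauliSystem x z) {C : Type*} [CStarAlgebra C]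
    [Nontrivial C] (f : B →⋆ₐ[ℂ] C) {y : B} (hy : y ∈ pauliClosure x z) : ‖f y‖ = ‖y‖ := by
  have hcl : IsClosed {y : B | ‖f y‖ = ‖y‖} :=
    isClosed_eq (map_continuous f).norm continuous_norm
  refine closure_minimal ?_ hcl (pauliClosure_subset_closure hy)
  refine Set.iUnion_subset fun n d hd => ?_
  have := h.isClosed_pauliStage n
  refine NonUnitalStarAlgHom.norm_map (f.comp (pauliStage x z n).subtype) ?_ ⟨d, hd⟩
  rw [injective_iff_map_eq_zero]
  exact fun a ha => Subtype.ext (h.eq_zero_of_map_eq_zero f a.2 ha)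

/-- A C⋆-algebra generated by a Pauli system is universal for the Pauli relations. -/
theorem exists_starAlgHom (h : IsPauliSystem x z) [Nontrivial B] (hB : pauliClosure x z = ⊤)
    {C : Type*} [CStarAlgebra C] {x' z' : ℕ → C} (h' : IsPauliSystem x' z') :
    ∃ Φ : B →⋆ₐ[ℂ] C, ∀ n, Φ (x n) = x' n ∧ Φ (z n) = z' n := by
  -- The closure generated in `B × C` is the graph of the desired map: its projection to `B` is
  -- isometric and onto, even if `C` is zero. Invert it and project to `C`.
  let X : ℕ → B × C := fun n => (x n, x' n)
  let Z : ℕ → B × C := fun n => (z n, z' n)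
  have H : IsPauliSystem X Z :=
    { star_x := fun n => Prod.ext (h.star_x n) (h'.star_x n)
      star_z := fun n => Prod.ext (h.star_z n) (h'.star_z n)
      x_mul_x := fun n => Prod.ext (h.x_mul_x n) (h'.x_mul_x n)
      z_mul_z := fun n => Prod.ext (h.z_mul_z n) (h'.z_mul_z n)
      z_mul_x := fun n => Prod.ext (h.z_mul_x n) (h'.z_mul_x n)
      commute_x := fun n m hnm => Prod.ext (h.commute_x n m hnm) (h'.commute_x n m hnm)
      commute_z := fun n m hnm => Prod.ext (h.commute_z n m hnm) (h'.commute_z n m hnm)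
      commute_xz := fun n m hnm => Prod.ext (h.commute_xz n m hnm) (h'.commute_xz n m hnm) }
  have hcl : IsClosed (pauliClosure X Z : Set (B × C)) := isClosed_pauliClosure
  let π : pauliClosure X Z →⋆ₐ[ℂ] B := (StarAlgHom.fst ℂ B C).comp (pauliClosure X Z).subtype
  have hiso : Isometry π := AddMonoidHomClass.isometry_of_norm π fun d =>
    H.norm_map_of_mem_pauliClosure (StarAlgHom.fst ℂ B C) d.2
  have hsurj : Function.Surjective π := by
    have hle : pauliClosure x z ≤ π.range := pauliClosure_le
      hiso.isClosedEmbedding.isClosed_range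
      (fun n => ⟨⟨X n, x_mem_pauliClosure n⟩, rfl⟩) (fun n => ⟨⟨Z n, z_mem_pauliClosure n⟩, rfl⟩)
    intro b
    have hb : b ∈ pauliClosure x z := hB ▸ StarSubalgebra.mem_top
    exact hle hb
  let e := StarAlgEquiv.ofBijective π ⟨hiso.injective, hsurj⟩
  refine ⟨(StarAlgHom.snd ℂ B C).comp ((pauliClosure X Z).subtype.comp
    (e.symm : B →⋆ₐ[ℂ] pauliClosure X Z)), fun n => ⟨?_, ?_⟩⟩
  · have : e.symm (x n) = ⟨X n, x_mem_pauliClosure n⟩ := e.symm_apply_eq.2 rfl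
    exact congrArg (fun d : pauliClosure X Z => (d : B × C).2) this
  · have : e.symm (z n) = ⟨Z n, z_mem_pauliClosure n⟩ := e.symm_apply_eq.2 rfl
    exact congrArg (fun d : pauliClosure X Z => (d : B × C).2) this

end IsPauliSystem
end Stage

/-! ### CAR algebras are the nontrivial C⋆-algebras generated by Pauli systems. -/

section CAR

variable {B : Type u} [CStarAlgebra B] {x z : ℕ → B}

theorem starAlgHom_range_le {θ : CStarMatrix (Fin 2) (Fin 2) ℂ →⋆ₐ[ℂ] B} {U : StarSubalgebra ℂ B}
    (hX : θ sigmaX ∈ U) (hZ : θ sigmaZ ∈ U) : θ.range ≤ U := by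
  have h : (⊤ : StarSubalgebra ℂ (CStarMatrix (Fin 2) (Fin 2) ℂ)) ≤ U.comap θ := by
    rw [← adjoin_sigmaX_sigmaZ, StarAlgebra.adjoin_le_iff]
    rintro _ (rfl | rfl)
    exacts [hX, hZ]
  rintro _ ⟨M, rfl⟩
  exact h (StarSubalgebra.mem_top (x := M))

theorem starAlgHom_matrix_injective [Nontrivial B]
    (θ : CStarMatrix (Fin 2) (Fin 2) ℂ →⋆ₐ[ℂ] B) : Function.Injective θ := by
  have : IsSimpleRing (CStarMatrix (Fin 2) (Fin 2) ℂ) :=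
    inferInstanceAs (IsSimpleRing (Matrix (Fin 2) (Fin 2) ℂ))
  exact RingHom.injective (θ : CStarMatrix (Fin 2) (Fin 2) ℂ →+* B)

theorem starAlgHom_range_le_centralizer {x' z' : B} {T : StarSubalgebra ℂ B}
    {θ : CStarMatrix (Fin 2) (Fin 2) ℂ →⋆ₐ[ℂ] B} (hX : θ sigmaX = x') (hZ : θ sigmaZ = z')
    (hTx : ∀ a ∈ T, Commute a x') (hTz : ∀ a ∈ T, Commute a z') :
    θ.range ≤ StarSubalgebra.centralizer ℂ (T : Set B) := by
  refine starAlgHom_range_le ?_ ?_ <;> rw [StarSubalgebra.mem_centralizer_iff]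
  · exact fun a ha => ⟨hX ▸ hTx a ha, hX ▸ hTx _ (star_mem ha)⟩
  · exact fun a ha => ⟨hZ ▸ hTz a ha, hZ ▸ hTz _ (star_mem ha)⟩

theorem isPauliSystem_of_commute (ψ : ℕ → CStarMatrix (Fin 2) (Fin 2) ℂ →⋆ₐ[ℂ] B)
    (hψ : ∀ n m, n ≠ m → ∀ M N, Commute (ψ n M) (ψ m N)) :
    IsPauliSystem (fun n => ψ n sigmaX) (fun n => ψ n sigmaZ) where
  star_x n := by rw [← map_star, star_sigmaX]
  star_z n := by rw [← map_star, star_sigmaZ]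
  x_mul_x n := by rw [← map_mul, sigmaX_mul_self, map_one]
  z_mul_z n := by rw [← map_mul, sigmaZ_mul_self, map_one]
  z_mul_x n := by rw [← map_mul, sigmaZ_mul_sigmaX, map_neg, map_mul]
  commute_x n m hnm := hψ n m hnm _ _
  commute_z n m hnm := hψ n m hnm _ _
  commute_xz n m hnm := hψ n m hnm _ _

open scoped ComplexOrder in
/-- A nontrivial C⋆-algebra generated by a Pauli system is the CAR algebra. -/
theorem IsPauliSystem.isCARAlgebra (h : IsPauliSystem x z) [Nontrivial B]
    (hB : pauliClosure x z = ⊤) : IsCARAlgebra B := by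
  choose θ hX hZ using fun n => exists_starAlgHom_of_anticommute (h.star_x n) (h.star_z n)
    (h.x_mul_x n) (h.z_mul_z n) (h.z_mul_x n)
  refine ⟨fun n => (θ n).range,
    fun n => ⟨(StarAlgEquiv.ofInjective (θ n) (starAlgHom_matrix_injective (θ n))).symm⟩, ?_⟩
  refine ⟨fun n => ?_, fun n m hnm a ha b hb => ?_, ?_, fun C _ φ hφ => ?_⟩
  · exact (NonUnitalStarAlgHom.isometry (θ n)
      (starAlgHom_matrix_injective (θ n))).isClosedEmbedding.isClosed_range
  · have comm : ∀ c, star c = c → Commute (x n) c → Commute (z n) c →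
        ∀ a ∈ (θ n).range, Commute a c := fun c hc hxc hzc a ha => by
      have hle : (θ n).range ≤ StarSubalgebra.centralizer ℂ {c} := by
        refine starAlgHom_range_le ?_ ?_ <;>
          simp only [StarSubalgebra.mem_centralizer_iff, Set.mem_singleton_iff, forall_eq, hc]
        · exact ⟨hX n ▸ hxc.symm, hX n ▸ hxc.symm⟩
        · exact ⟨hZ n ▸ hzc.symm, hZ n ▸ hzc.symm⟩
      exact ((StarSubalgebra.mem_centralizer_iff ℂ).1 (hle ha) c rfl).1.symm
    have hle := starAlgHom_range_le_centralizer (hX m) (hZ m)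
      (comm _ (h.star_x m) (h.commute_x n m hnm) (h.commute_xz m n hnm.symm).symm)
      (comm _ (h.star_z m) (h.commute_xz n m hnm) (h.commute_z n m hnm))
    exact ((StarSubalgebra.mem_centralizer_iff ℂ).1 (hle hb) a ha).1
  · rw [eq_top_iff, ← hB]
    refine pauliClosure_le (StarSubalgebra.isClosed_topologicalClosure _) (fun n => ?_) fun n => ?_
    · exact StarSubalgebra.le_topologicalClosure _
        (le_iSup (fun n => (θ n).range) n ⟨sigmaX, hX n⟩)
    · exact StarSubalgebra.le_topologicalClosure _
        (le_iSup (fun n => (θ n).range) n ⟨sigmaZ, hZ n⟩)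
  · let ψ : ∀ n, CStarMatrix (Fin 2) (Fin 2) ℂ →⋆ₐ[ℂ] C := fun n => (φ n).comp (θ n).rangeRestrict
    have hψ : ∀ n m, n ≠ m → ∀ M N, Commute (ψ n M) (ψ m N) := fun n m hnm M N =>
      hφ n m hnm _ _
    have h' := isPauliSystem_of_commute ψ hψ
    obtain ⟨Φ, hΦ⟩ := h.exists_starAlgHom hB h'
    refine ⟨Φ, fun n a => ?_⟩
    obtain ⟨_, M, rfl⟩ := a
    have heq : Φ.comp (θ n) = ψ n := by
      refine StarAlgHom.ext_of_adjoin_eq_top adjoin_sigmaX_sigmaZ ?_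
      rintro _ (rfl | rfl)
      · simpa only [StarAlgHom.comp_apply, hX] using (hΦ n).1
      · simpa only [StarAlgHom.comp_apply, hZ] using (hΦ n).2
    exact DFunLike.congr_fun heq M

/-- The C⋆-subalgebra generated by a Pauli system is the CAR algebra. -/
theorem IsPauliSystem.isCARAlgebra_pauliClosure (h : IsPauliSystem x z) [Nontrivial B]
    [IsClosed (pauliClosure x z : Set B)] : IsCARAlgebra (pauliClosure x z) := by
  let X : ℕ → pauliClosure x z := fun n => ⟨x n, x_mem_pauliClosure n⟩
  let Z : ℕ → pauliClosure x z := fun n => ⟨z n, z_mem_pauliClosure n⟩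
  have H : IsPauliSystem X Z :=
    { star_x := fun n => Subtype.ext (h.star_x n)
      star_z := fun n => Subtype.ext (h.star_z n)
      x_mul_x := fun n => Subtype.ext (h.x_mul_x n)
      z_mul_z := fun n => Subtype.ext (h.z_mul_z n)
      z_mul_x := fun n => Subtype.ext (h.z_mul_x n)
      commute_x := fun n m hnm => Subtype.ext (h.commute_x n m hnm)
      commute_z := fun n m hnm => Subtype.ext (h.commute_z n m hnm)
      commute_xz := fun n m hnm => Subtype.ext (h.commute_xz n m hnm) }
  refine H.isCARAlgebra ?_
  -- The inclusion is a closed embedding, so closures formed inside the subalgebra stay closed in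
  -- `B`.
  have hle : pauliClosure x z ≤ (pauliClosure X Z).map (pauliClosure x z).subtype :=
    pauliClosure_le
      ((IsClosed.isClosedEmbedding_subtypeVal isClosed_pauliClosure).isClosedMap _
        isClosed_pauliClosure)
      (fun n => ⟨X n, x_mem_pauliClosure n, rfl⟩) (fun n => ⟨Z n, z_mem_pauliClosure n, rfl⟩)
  rw [StarSubalgebra.eq_top_iff]
  intro a
  obtain ⟨b, hb, hba⟩ := hle a.2
  rwa [← Subtype.ext hba]

theorem IsCARAlgebra.exists_isPauliSystem (hB : IsCARAlgebra B) :
    Nontrivial B ∧ ∃ x z : ℕ → B, IsPauliSystem x z ∧ pauliClosure x z = ⊤ := by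
  obtain ⟨S, hS, hT⟩ := hB
  let e := fun n => (hS n).some
  let ψ : ∀ n, CStarMatrix (Fin 2) (Fin 2) ℂ →⋆ₐ[ℂ] B := fun n =>
    (S n).subtype.comp ((e n).symm : CStarMatrix (Fin 2) (Fin 2) ℂ →⋆ₐ[ℂ] S n)
  have hψ : ∀ n m, n ≠ m → ∀ M N, Commute (ψ n M) (ψ m N) := fun n m hnm M N =>
    hT.commute n m hnm _ (Subtype.property _) _ (Subtype.property _)
  have hinj : Function.Injective (ψ 0) := Subtype.val_injective.comp (e 0).symm.injective
  refine ⟨hinj.nontrivial, fun n => ψ n sigmaX, fun n => ψ n sigmaZ, ?_, ?_⟩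
  · exact isPauliSystem_of_commute ψ hψ
  · rw [eq_top_iff, ← hT.generates]
    refine StarSubalgebra.topologicalClosure_minimal (iSup_le fun n a ha => ?_) isClosed_pauliClosure
    have hle : (ψ n).range ≤ pauliClosure (fun n => ψ n sigmaX) (fun n => ψ n sigmaZ) :=
      starAlgHom_range_le (x_mem_pauliClosure (x := fun n => ψ n sigmaX) n)
        (z_mem_pauliClosure (z := fun n => ψ n sigmaZ) n)
    refine hle ⟨e n ⟨a, ha⟩, ?_⟩
    exact congrArg Subtype.val ((e n).symm_apply_apply ⟨a, ha⟩)

end CAR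

/-! ### The even subalgebra: properness and trivial relative commutant. -/

/-- The products `z 0 * ⋯ * z n` of the first members of a sequence. -/
def zString {B : Type*} [Mul B] (z : ℕ → B) : ℕ → B
  | 0 => z 0
  | n + 1 => zString z n * z (n + 1)

section Even

variable {B : Type*} [CStarAlgebra B] {x z : ℕ → B}

namespace IsPauliSystem

theorem commute_x' (h : IsPauliSystem x z) (n m : ℕ) : Commute (x n) (x m) := by
  rcases eq_or_ne n m with rfl | hnm
  exacts [Commute.refl _, h.commute_x n m hnm]

theorem commute_z' (h : IsPauliSystem x z) (n m : ℕ) : Commute (z n) (z m) := by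
  rcases eq_or_ne n m with rfl | hnm
  exacts [Commute.refl _, h.commute_z n m hnm]

theorem commute_z_zString (h : IsPauliSystem x z) (m n : ℕ) : Commute (z m) (zString z n) := by
  induction n with
  | zero => exact h.commute_z' m 0
  | succ n ih => exact ih.mul_right (h.commute_z' m (n + 1))

theorem commute_x_zString (h : IsPauliSystem x z) {m n : ℕ} (hnm : n < m) :
    Commute (x m) (zString z n) := by
  induction n with
  | zero => exact h.commute_xz m 0 (by omega)
  | succ n ih => exact (ih (by omega)).mul_right (h.commute_xz m (n + 1) (by omega))

theorem zString_mul_x (h : IsPauliSystem x z) {m n : ℕ} (hmn : m ≤ n) :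
    zString z n * x m = -(x m * zString z n) := by
  induction n with
  | zero =>
    obtain rfl : m = 0 := by omega
    exact h.z_mul_x 0
  | succ n ih =>
    rw [zString]
    rcases Nat.le_succ_iff.1 hmn with hm | rfl
    · rw [mul_assoc, ← (h.commute_xz m (n + 1) (by omega)).eq, ← mul_assoc, ih hm, neg_mul,
        mul_assoc]
    · rw [mul_assoc, h.z_mul_x, mul_neg, ← mul_assoc, ← (h.commute_x_zString n.lt_succ_self).eq,
        mul_assoc]

theorem star_zString (h : IsPauliSystem x z) (n : ℕ) : star (zString z n) = zString z n := by
  induction n with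
  | zero => exact h.star_z 0
  | succ n ih => rw [zString, star_mul, ih, h.star_z, (h.commute_z_zString _ _).eq]

theorem zString_mul_self (h : IsPauliSystem x z) (n : ℕ) : zString z n * zString z n = 1 := by
  induction n with
  | zero => exact h.z_mul_z 0
  | succ n ih =>
    rw [zString, (h.commute_z_zString (n + 1) n).mul_mul_mul_comm, ih, h.z_mul_z, one_mul]

theorem commute_zString (h : IsPauliSystem x z) (m n : ℕ) :
    Commute (zString z m) (zString z n) := by
  induction m with
  | zero => exact h.commute_z_zString 0 n
  | succ m ih => exact ih.mul_left (h.commute_z_zString (m + 1) n)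

/-- The Pauli system generating the fixed points of the automorphism `x n ↦ -x n`, `z n ↦ z n`. -/
theorem even (h : IsPauliSystem x z) :
    IsPauliSystem (fun n => x n * x (n + 1)) (zString z) where
  star_x n := by rw [star_mul, h.star_x, h.star_x, (h.commute_x' _ _).eq]
  star_z := h.star_zString
  x_mul_x n := by
    rw [(h.commute_x' (n + 1) n).mul_mul_mul_comm, h.x_mul_x, h.x_mul_x, one_mul]
  z_mul_z := h.zString_mul_self
  z_mul_x n := by
    rw [← mul_assoc, h.zString_mul_x le_rfl, neg_mul, mul_assoc,
      ← (h.commute_x_zString n.lt_succ_self).eq, mul_assoc]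
  commute_x n m _ := ((h.commute_x' _ _).mul_right (h.commute_x' _ _)).mul_left
    ((h.commute_x' _ _).mul_right (h.commute_x' _ _))
  commute_z n m _ := h.commute_zString n m
  commute_xz n m hnm := by
    -- For `n < m` the string contains both `z n` and `z (n + 1)`, so two signs cancel; for `m < n`
    -- it contains neither.
    rcases lt_or_gt_of_ne hnm with hlt | hlt
    · rw [commute_iff_eq, ← mul_assoc, h.zString_mul_x hlt.le, neg_mul, mul_assoc, mul_assoc,
        h.zString_mul_x (Nat.succ_le_of_lt hlt), mul_neg, neg_neg]
    · exact (h.commute_x_zString hlt).mul_left (h.commute_x_zString (hlt.trans n.lt_succ_self))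

/-- The generators `x n` do not belong to the even subalgebra. -/
theorem x_notMem_even (h : IsPauliSystem x z) [Nontrivial B] (hB : pauliClosure x z = ⊤) (n : ℕ) :
    x n ∉ pauliClosure (fun n => x n * x (n + 1)) (zString z) := by
  have h' : IsPauliSystem (fun n => -x n) z :=
    { star_x := fun n => by rw [star_neg, h.star_x]
      star_z := h.star_z
      x_mul_x := fun n => by rw [neg_mul_neg, h.x_mul_x]
      z_mul_z := h.z_mul_z
      z_mul_x := fun n => by rw [mul_neg, h.z_mul_x, neg_mul]
      commute_x := fun n m hnm => (h.commute_x n m hnm).neg_left.neg_right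
      commute_z := h.commute_z
      commute_xz := fun n m hnm => (h.commute_xz n m hnm).neg_left }
  obtain ⟨α, hα⟩ := h.exists_starAlgHom hB h'
  have hz : ∀ n, α (zString z n) = zString z n := fun n => by
    induction n with
    | zero => exact (hα 0).2
    | succ n ih => rw [zString, map_mul, ih, (hα _).2]
  have hcont : Continuous α :=
    AddMonoidHomClass.continuous_of_bound α 1 fun b => by
      simpa only [one_mul] using NonUnitalStarAlgHom.norm_apply_le α b
  have hle : pauliClosure (fun n => x n * x (n + 1)) (zString z) ≤
      StarAlgHom.equalizer α (StarAlgHom.id ℂ B) :=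
    pauliClosure_le (isClosed_eq hcont continuous_id)
      (fun n => by
        change α (x n * x (n + 1)) = x n * x (n + 1)
        rw [map_mul, (hα n).1, (hα (n + 1)).1, neg_mul_neg])
      hz
  intro hx
  have hfix : α (x n) = x n := hle hx
  have h2 : (2 : ℂ) • x n = 0 := by
    rw [two_smul, ← eq_neg_iff_add_eq_zero]
    exact hfix.symm.trans (hα n).1
  have h0 : x n = 0 := (smul_eq_zero.1 h2).resolve_left two_ne_zero
  have := h.x_mul_x n
  rw [h0, zero_mul] at this
  exact zero_ne_one this

/-- Consecutive strings differ by one factor and square to one, so their product recovers it. -/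
theorem z_mem_even (h : IsPauliSystem x z) (n : ℕ) :
    z n ∈ pauliClosure (fun n => x n * x (n + 1)) (zString z) := by
  cases n with
  | zero => exact z_mem_pauliClosure (z := zString z) 0
  | succ n =>
    have hn : z (n + 1) = zString z n * zString z (n + 1) := by
      rw [zString, ← mul_assoc, h.zString_mul_self, one_mul]
    rw [hn]
    exact mul_mem (z_mem_pauliClosure n) (z_mem_pauliClosure (n + 1))

/-- An element commuting with the even subalgebra is at least as close to the scalars as to any
element of a finite stage. -/
theorem exists_norm_algebraMap_sub_le (h : IsPauliSystem x z) {b : B}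
    (hb : ∀ a ∈ pauliClosure (fun n => x n * x (n + 1)) (zString z), Commute a b) {n : ℕ} {y : B}
    (hy : y ∈ pauliStage x z n) : ∃ c : ℂ, ‖algebraMap ℂ B c - b‖ ≤ ‖y - b‖ := by
  induction n generalizing y with
  | zero =>
    rw [pauliStage_zero] at hy
    obtain ⟨c, rfl⟩ := StarSubalgebra.mem_bot.1 hy
    exact ⟨c, le_rfl⟩
  | succ n ih =>
    obtain ⟨a₀, h₀, a₁, h₁, a₂, h₂, a₃, h₃, rfl⟩ := h.exists_decomposition hy
    obtain ⟨c, hc⟩ := ih h₀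
    -- Here `w = x n * x (n + 1)`: it anticommutes with `z n` as `x n` does, but it lies in the even
    -- subalgebra and so commutes with `b`.
    refine ⟨c, hc.trans (h.norm_coeff_sub_le h₀ h₁ h₂ h₃ (h.even.star_x n) (h.even.x_mul_x n)
      (fun d hd => ?_) ?_ (hb _ (h.z_mem_even n)) (hb _ (x_mem_pauliClosure n)))⟩
    · exact (h.commute_x_pauliStage le_rfl hd).mul_left (h.commute_x_pauliStage n.le_succ hd)
    · rw [mul_assoc, (h.commute_xz (n + 1) n (by omega)).eq, ← mul_assoc, h.x_mul_z, neg_mul,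
        mul_assoc]

/-- The even subalgebra has trivial relative commutant. -/
theorem centralizer_even (h : IsPauliSystem x z) (hB : pauliClosure x z = ⊤) :
    StarSubalgebra.centralizer ℂ
      (pauliClosure (fun n => x n * x (n + 1)) (zString z) : Set B) = ⊥ := by
  rw [eq_bot_iff]
  intro b hb
  have hcomm : ∀ a ∈ pauliClosure (fun n => x n * x (n + 1)) (zString z), Commute a b :=
    fun a ha => ((StarSubalgebra.mem_centralizer_iff ℂ).1 hb a ha).1
  have hcl : IsClosed ((⊥ : StarSubalgebra ℂ B) : Set B) :=
    pauliStage_zero (x := x) (z := z) ▸ h.isClosed_pauliStage 0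
  rw [← SetLike.mem_coe, ← hcl.closure_eq, Metric.mem_closure_iff]
  intro ε hε
  have hbB : b ∈ pauliClosure x z := hB ▸ StarSubalgebra.mem_top
  obtain ⟨y, hy, hyb⟩ := Metric.mem_closure_iff.1 (pauliClosure_subset_closure hbB) ε hε
  obtain ⟨n, hn⟩ := Set.mem_iUnion.1 hy
  obtain ⟨c, hc⟩ := h.exists_norm_algebraMap_sub_le hcomm hn
  refine ⟨algebraMap ℂ B c, StarSubalgebra.mem_bot.2 ⟨c, rfl⟩, ?_⟩
  rw [dist_comm, dist_eq_norm] at hyb ⊢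
  exact hc.trans_lt hyb

end IsPauliSystem

end Even

/-! ### A spin chain represented on a Hilbert space. -/

section Existence

variable {ι : Type u}

/-- A signed permutation of the index set that is a self-inverse operation gives a self-adjoint
operator on the square-summable sequences. -/
theorem exists_signedPerm (σ : Equiv.Perm ι) (s : ι → ℝ) (hs : ∀ i, |s i| = 1)
    (hσ : ∀ i, σ (σ i) = i) (hsσ : ∀ i, s (σ i) = s i) :
    ∃ T : lp (fun _ : ι => ℂ) 2 →L[ℂ] lp (fun _ : ι => ℂ) 2,
      star T = T ∧ ∀ f i, T f i = s i * f (σ i) := by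
  have hn : ∀ (f : lp (fun _ : ι => ℂ) 2) i, ‖(s i : ℂ) * f (σ i)‖ = ‖f (σ i)‖ := fun f i => by
    rw [norm_mul, Complex.norm_real, Real.norm_eq_abs, hs, one_mul]
  have h2 : (0 : ℝ) < (2 : ENNReal).toReal := by norm_num
  have hmem : ∀ f : lp (fun _ : ι => ℂ) 2,
      Memℓp (fun i => (s i : ℂ) * f (σ i) : ∀ _ : ι, ℂ) 2 := fun f => by
    rw [memℓp_gen_iff h2]
    simp only [hn]
    exact σ.summable_iff.2 ((memℓp_gen_iff h2).1 (lp.memℓp f))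
  let L : lp (fun _ : ι => ℂ) 2 →ₗ[ℂ] lp (fun _ : ι => ℂ) 2 :=
    { toFun := fun f => ⟨fun i => s i * f (σ i), hmem f⟩
      map_add' := fun f g => lp.ext (funext fun i => mul_add _ _ _)
      map_smul' := fun c f => lp.ext (funext fun i => mul_left_comm _ _ _) }
  have hL : ∀ f i, L f i = s i * f (σ i) := fun _ _ => rfl
  have hnorm : ∀ f, ‖L f‖ = ‖f‖ := fun f => by
    rw [lp.norm_eq_tsum_rpow h2, lp.norm_eq_tsum_rpow h2]
    simp only [hL, hn]
    rw [σ.tsum_eq fun i => ‖f i‖ ^ (2 : ENNReal).toReal]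
  refine ⟨L.mkContinuous 1 fun f => by rw [hnorm, one_mul], ?_, hL⟩
  rw [ContinuousLinearMap.star_eq_adjoint, eq_comm, ContinuousLinearMap.eq_adjoint_iff]
  intro f g
  rw [lp.inner_eq_tsum, lp.inner_eq_tsum, ← σ.tsum_eq]
  refine tsum_congr fun i => ?_
  simp only [LinearMap.mkContinuous_apply, hL, hσ, hsσ, RCLike.inner_apply, map_mul,
    Complex.conj_ofReal]
  ring

/-- The CAR algebra exists, as an algebra of operators on the square-summable families indexed by the
finite sets of natural numbers. -/
theorem exists_isCARAlgebra : ∃ (B : Type u) (_ : CStarAlgebra B), IsCARAlgebra B := by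
  -- A finite set lists the flipped spins: `x n` toggles membership of `n`, and `z n` is the sign
  -- `-1` exactly on sets containing `n`.
  let ι := ULift.{u} (Finset ℕ)
  let flip : ℕ → ι → ι := fun n i => ⟨symmDiff i.down {n}⟩
  have hflip : ∀ n, Function.Involutive (flip n) := fun n i =>
    ULift.ext _ _ (symmDiff_symmDiff_cancel_right _ _)
  have hcomm : ∀ n m i, flip n (flip m i) = flip m (flip n i) := fun n m i =>
    ULift.ext _ _ (symmDiff_right_comm _ _ _)
  let sgn : ℕ → ι → ℝ := fun n i => if n ∈ i.down then -1 else 1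
  have hsgn : ∀ n i, sgn n i * sgn n i = 1 := fun n i => by
    simp only [sgn]; split_ifs <;> norm_num
  have habs : ∀ n i, |sgn n i| = 1 := fun n i => by
    simp only [sgn]; split_ifs <;> norm_num
  have hsf : ∀ n i, sgn n (flip n i) = -sgn n i := fun n i => by
    by_cases h : n ∈ i.down <;> simp [sgn, flip, Finset.mem_symmDiff, h]
  have hsf' : ∀ n m, n ≠ m → ∀ i, sgn n (flip m i) = sgn n i := fun n m hnm i => by
    by_cases h : n ∈ i.down <;> simp [sgn, flip, Finset.mem_symmDiff, h, hnm]
  choose x hx hx' using fun n => exists_signedPerm (hflip n).toPerm (fun _ => 1)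
    (fun _ => abs_one) (hflip n) fun _ => rfl
  choose z hz hz' using fun n => exists_signedPerm (Equiv.refl ι) (sgn n)
    (habs n) (fun _ => rfl) fun _ => rfl
  replace hx' : ∀ n f i, x n f i = f (flip n i) := fun n f i => by
    rw [hx']; simp
  replace hz' : ∀ n f i, z n f i = sgn n i * f i := fun n f i => hz' n f i
  have h : IsPauliSystem x z := by
    refine ⟨hx, hz, fun n => ?_, fun n => ?_, fun n => ?_, fun n m _ => ?_, fun n m _ => ?_,
      fun n m hnm => ?_⟩ <;> refine ContinuousLinearMap.ext fun f => lp.ext (funext fun i => ?_)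
    · change x n (x n f) i = f i
      rw [hx', hx', hflip]
    · change z n (z n f) i = f i
      rw [hz', hz', ← mul_assoc, ← Complex.ofReal_mul, hsgn, Complex.ofReal_one, one_mul]
    · change z n (x n f) i = -x n (z n f) i
      rw [hz', hx', hx', hz', hsf, Complex.ofReal_neg, neg_mul, neg_neg]
    · change x n (x m f) i = x m (x n f) i
      rw [hx', hx', hx', hx', hcomm]
    · change z n (z m f) i = z m (z n f) i
      rw [hz', hz', hz', hz', mul_left_comm]
    · change x n (z m f) i = z m (x n f) i
      rw [hx', hz', hz', hx', hsf' m n hnm.symm]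
  have : IsClosed (pauliClosure x z : Set (lp (fun _ : ι => ℂ) 2 →L[ℂ] lp (fun _ : ι => ℂ) 2)) :=
    isClosed_pauliClosure
  have : Nontrivial (lp (fun _ : ι => ℂ) 2) :=
    ⟨lp.single 2 ⟨∅⟩ 1, 0, fun h => by
      have := congrArg (fun f : lp (fun _ : ι => ℂ) 2 => f ⟨∅⟩) h
      simp at this⟩
  exact ⟨pauliClosure x z, inferInstance, h.isCARAlgebra_pauliClosure⟩

end Existence

theorem mainTheorem9 :
    -- the CAR algebra exists
    (∃ (B : Type u) (_ : CStarAlgebra B), IsCARAlgebra B) ∧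
    ∀ (B : Type u) [CStarAlgebra B], IsCARAlgebra B →
      ∃ (A : StarSubalgebra ℂ B) (_ : IsClosed (A : Set B)),
        A ≠ ⊤ ∧
        IsCARAlgebra A ∧
        StarSubalgebra.centralizer ℂ (A : Set B) = ⊥ ∧
        -- `B` is not `A ⊗ Z_B(A)`, and is not even generated by `A` and `Z_B(A)`
        ¬ IsCStarTensorProduct
            (fun i : Bool => if i then A else StarSubalgebra.centralizer ℂ (A : Set B)) ∧
        (A ⊔ StarSubalgebra.centralizer ℂ (A : Set B)).topologicalClosure ≠ ⊤ := by
  refine ⟨exists_isCARAlgebra, fun B _ hB => ?_⟩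
  obtain ⟨_, x, z, h, hgen⟩ := hB.exists_isPauliSystem
  have hcl : IsClosed (pauliClosure (fun n => x n * x (n + 1)) (zString z) : Set B) :=
    isClosed_pauliClosure
  have hne : pauliClosure (fun n => x n * x (n + 1)) (zString z) ≠ ⊤ := fun htop =>
    h.x_notMem_even hgen 0 (htop ▸ StarSubalgebra.mem_top)
  have hcent := h.centralizer_even hgen
  refine ⟨_, hcl, hne, h.even.isCARAlgebra_pauliClosure, hcent, fun hT => hne ?_, fun hT => hne ?_⟩
  · rw [eq_top_iff, ← hT.generates]
    refine StarSubalgebra.topologicalClosure_minimal (iSup_le fun i => ?_) hcl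
    cases i
    · simp [hcent]
    · simp
  · rw [eq_top_iff, ← hT, hcent]
    exact StarSubalgebra.topologicalClosure_minimal (sup_le le_rfl bot_le) hcl
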